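/- Let $d \ge 2$, $\omega > 0$ and $\lambda_1,\dots,\lambda_d > 0$. For $k \in \mathbb{R}^d$ put $$\gamma(k) = \sqrt{\omega^2 + 4\sum_{j=1}^d \lambda_j \sin^2(k_j/2)},$$ and for $t \in \mathbb{R}$, $x \in \mathbb{Z}^d$ put $\phi_{t,x}(k) = k\cdot x - 2t\gamma(k)$. Let $\mathbb{T}^d = (-\pi,\pi]^d$ be the torus (opposite faces identified) with Lebesgue measure, so that $C^1(\mathbb{T}^d)$ consists of the $C^1$ functions $\mathbb{R}^d \to \mathbb{C}$ that are $2\pi$-periodic in each coordinate. Then there is a constant $C$, depending only on $d$, $\omega$ and $\lambda_1,\dots,\lambda_d$ (in particular not on $t$, $x$ or $\eta$), such that for all $\eta \in C^1(\mathbb{T}^d)$, all $x \in \mathbb{Z}^d$ and all $t \in \mathbb{R}$ with $|t| \ge 1$, $$\left|\int_{\mathbb{T}^d} e^{i\phi_{t,x}(k)}\,\eta(k)\,dk\right| \le \frac{C}{|t|^{1/2}}\left(\|\nabla\eta\|_1 + \|\eta\|_1\right),$$ where $\|\eta\|_1 = \int_{\mathbb{T}^d} |\eta(k)|\,dk$ and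 $\|\nabla\eta\|_1 = \int_{\mathbb{T}^d} \sum_{j=1}^d \left|\frac{\partial\eta}{\partial k_j}(k)\right| dk$. -/

import Mathlib

noncomputable section

namespace HarmonicLattice

/-- The fundamental domain `(-π, π]^d` of the torus `𝕋^d = ℝ^d / (2πℤ)^d`. -/
def torusBox (d : ℕ) : Set (Fin d → ℝ) :=
  Set.univ.pi fun _ => Set.Ioc (-Real.pi) Real.pi

/-- `f ∈ C¹(𝕋^d)`: a complex valued function on the torus is regarded as a function on `ℝ^d` that is
`2π`-periodic in every coordinate; being `C¹` on the torus is being `C¹` on `ℝ^d`. -/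
def IsC1Torus {d : ℕ} (f : (Fin d → ℝ) → ℂ) : Prop :=
  ContDiff ℝ 1 f ∧
    ∀ (k : Fin d → ℝ) (j : Fin d), f (k + Pi.single j (2 * Real.pi)) = f k

/-- The dispersion relation `γ(k) = √(ω² + 4 ∑_j λ_j sin²(k_j / 2))`. -/
def gam {d : ℕ} (ω : ℝ) (lam : Fin d → ℝ) (k : Fin d → ℝ) : ℝ :=
  Real.sqrt (ω ^ 2 + 4 * ∑ j, lam j * Real.sin (k j / 2) ^ 2)

/-- The phase `φ_{t,x}(k) = k · x - 2 t γ(k)`. -/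
def phase {d : ℕ} (ω : ℝ) (lam : Fin d → ℝ) (t : ℝ) (x : Fin d → ℤ) (k : Fin d → ℝ) : ℝ :=
  (∑ j, k j * (x j : ℝ)) - 2 * t * gam ω lam k

/-- The norm `‖f‖₁` on `L¹(𝕋^d)`, with respect to Lebesgue measure on `(-π, π]^d`. -/
def torusL1 {d : ℕ} (f : (Fin d → ℝ) → ℂ) : ℝ :=
  ∫ k in torusBox d, ‖f k‖

/-- The partial derivative `∂f/∂k_j`. -/
def partialDeriv {d : ℕ} (j : Fin d) (f : (Fin d → ℝ) → ℂ) (k : Fin d → ℝ) : ℂ :=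
  fderiv ℝ f k (Pi.single j 1)

/-- The norm `‖∇f‖₁ = ∫_{𝕋^d} ∑_j |∂f/∂k_j(k)| dk`. -/
def torusGradL1 {d : ℕ} (f : (Fin d → ℝ) → ℂ) : ℝ :=
  ∫ k in torusBox d, ∑ j, ‖partialDeriv j f k‖

end HarmonicLattice

end

/-!
The mechanism is that, in dimension at least two, the Hessian of the dispersion relation `γ` vanishes
nowhere. Since `∂_i ∂_j (γ² / 2) = δ_ij λ_i cos k_i`, one has
`γ ∂_i ∂_j γ = δ_ij λ_i cos k_i - ∂_i γ ∂_j γ` with `γ ∂_i γ = λ_i sin k_i`. If the derivatives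
`∂_a²γ`, `∂_b²γ` and `(∂_a + ∂_b)²γ` vanished at one point, then so would `∂_a γ ∂_b γ`, hence for
instance `sin k_a = 0`, and then `∂_a²γ = λ_a cos k_a / γ = ± λ_a / γ ≠ 0`
(`exists_gamDir₂_ne_zero`). By compactness, at every point one of the three second derivatives is
bounded below (`exists_pos_le_sum_sq_gamDir₂`), and a smooth partition of unity on the torus made of
functions of these derivatives reduces the claim to amplitudes supported where one of them, in the
direction `v` say, is bounded below (`exists_weighted_bound`).

For such an amplitude, translation invariance on the torus writes the integral as an average over
segments `k + [0, δ] v` (`IsTorusPeriodic.smul_setIntegral_eq`). With `δ` given by uniform continuity,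
either the amplitude vanishes on the segment, or the second derivative of the phase along the
segment has constant sign and is at least a constant times `|t|`; in the second case a van der Corput
estimate (`norm_oscillatory_integral_le`) gives the factor `|t| ^ (-1/2)`
(`exists_directional_bound`). The supremum of the amplitude on a segment of the fixed length `δ` is
controlled by the integrals of it and of its derivative, so that only `L¹` norms appear.
-/

open MeasureTheory Set

namespace HarmonicLattice

/-! ### One-dimensional oscillatory integrals -/

/-- The integrand is, up to the sign `σ`, the derivative of `arctan (f₁ / √μ) / √μ`, so its integral
is bounded independently of the length of the interval. -/
lemma integral_deriv_div_le_pi_div_sqrt {f₁ f₂ : ℝ → ℝ} {δ μ σ : ℝ} (hμ : 0 < μ)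
    (hσ : |σ| = 1) (hf₁ : ∀ s, HasDerivAt f₁ (f₂ s) s) (hf₂ : Continuous f₂) :
    ∫ s in (0)..δ, σ * f₂ s / (μ + f₁ s ^ 2) ≤ Real.pi / √μ := by
  have hq : 0 < √μ := Real.sqrt_pos.2 hμ
  have hsq : √μ ^ 2 = μ := Real.sq_sqrt hμ.le
  have hcf₁ : Continuous f₁ := continuous_iff_continuousAt.2 fun s => (hf₁ s).continuousAt
  have hder : ∀ s, HasDerivAt (fun s => σ / √μ * Real.arctan (f₁ s / √μ))
      (σ * f₂ s / (μ + f₁ s ^ 2)) s := by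
    intro s
    have h := (((hf₁ s).div_const (√μ)).arctan).const_mul (σ / √μ)
    refine h.congr_deriv ?_
    have h1 : μ + f₁ s ^ 2 ≠ 0 := by positivity
    have h2 : 1 + (f₁ s / √μ) ^ 2 = (μ + f₁ s ^ 2) / μ := by
      rw [div_pow, hsq]; field_simp
    rw [h2]
    field_simp
    rw [hsq]
  have hpos : ∀ s, μ + f₁ s ^ 2 ≠ 0 := fun s => by positivity
  have hcont : Continuous fun s => σ * f₂ s / (μ + f₁ s ^ 2) := by fun_prop (disch := assumption)
  rw [intervalIntegral.integral_eq_sub_of_hasDerivAt (fun s _ => hder s)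
    (hcont.intervalIntegrable _ _), ← mul_sub]
  refine (le_abs_self _).trans ?_
  rw [abs_mul, abs_div, hσ, abs_of_pos hq, div_mul_eq_mul_div, one_mul]
  gcongr
  rw [abs_le]
  constructor <;> linarith [Real.arctan_lt_pi_div_two (f₁ δ / √μ),
    Real.arctan_lt_pi_div_two (f₁ 0 / √μ), Real.neg_pi_div_two_lt_arctan (f₁ δ / √μ),
    Real.neg_pi_div_two_lt_arctan (f₁ 0 / √μ)]

/-- A van der Corput estimate with amplitude, for a phase `f` whose second derivative `f₂` satisfies
`μ ≤ σ f₂` with a fixed sign `σ = ±1`. The constant function is split as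
`1 = μ / (μ + f₁²) + f₁ w` with `w = f₁ / (μ + f₁²)`: the first summand is integrated absolutely, and
`f₁ exp (I f)` is integrated by parts against `w ψ`. This treats points close to and far from a zero
of `f₁` at once. -/
theorem norm_oscillatory_integral_le {f f₁ f₂ : ℝ → ℝ} {ψ ψ' : ℝ → ℂ} {δ μ σ M : ℝ}
    (hδ : 0 ≤ δ) (hμ : 0 < μ) (hσ : |σ| = 1)
    (hf : ∀ s, HasDerivAt f (f₁ s) s) (hf₁ : ∀ s, HasDerivAt f₁ (f₂ s) s) (hf₂ : Continuous f₂)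
    (hψ : ∀ s, HasDerivAt ψ (ψ' s) s) (hψ' : Continuous ψ')
    (hlow : ∀ s ∈ Icc 0 δ, μ ≤ σ * f₂ s) (hM : ∀ s ∈ Icc 0 δ, ‖ψ s‖ ≤ M) :
    ‖∫ s in (0)..δ, Complex.exp (Complex.I * f s) * ψ s‖ ≤
      9 / √μ * (M + ∫ s in (0)..δ, ‖ψ' s‖) := by
  have hq : 0 < √μ := Real.sqrt_pos.2 hμ
  have hsq : √μ ^ 2 = μ := Real.sq_sqrt hμ.le
  have hM0 : 0 ≤ M := (norm_nonneg _).trans (hM 0 ⟨le_rfl, hδ⟩)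
  have hcf : Continuous f := continuous_iff_continuousAt.2 fun s => (hf s).continuousAt
  have hcf₁ : Continuous f₁ := continuous_iff_continuousAt.2 fun s => (hf₁ s).continuousAt
  have hcψ : Continuous ψ := continuous_iff_continuousAt.2 fun s => (hψ s).continuousAt
  have hpos : ∀ s, 0 < μ + f₁ s ^ 2 := fun s => by positivity
  have hne : ∀ s, μ + f₁ s ^ 2 ≠ 0 := fun s => (hpos s).ne'
  have hnorm : ∀ r : ℝ, ‖Complex.exp (Complex.I * r)‖ = 1 := fun r => by
    rw [mul_comm]; exact Complex.norm_exp_ofReal_mul_I r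
  set w : ℝ → ℝ := fun s => f₁ s / (μ + f₁ s ^ 2) with hw
  set w' : ℝ → ℝ := fun s => f₂ s * (μ - f₁ s ^ 2) / (μ + f₁ s ^ 2) ^ 2 with hw'
  have hwder : ∀ s, HasDerivAt w (w' s) s := by
    intro s
    have h := (hf₁ s).div (((hf₁ s).pow 2).const_add μ) (hne s)
    refine h.congr_deriv ?_
    simp only [hw', Pi.pow_apply]
    congr 1
    push_cast
    ring
  have hne2 : ∀ s, (μ + f₁ s ^ 2) ^ 2 ≠ 0 := fun s => pow_ne_zero _ (hne s)
  have hcw : Continuous w := by fun_prop (disch := assumption)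
  have hcw' : Continuous w' := by fun_prop (disch := assumption)
  have hwle : ∀ s, |w s| ≤ 1 / √μ := by
    intro s
    simp only [hw]
    rw [abs_div, abs_of_pos (hpos s), div_le_div_iff₀ (hpos s) hq]
    have h1 := sq_abs (f₁ s)
    nlinarith [sq_nonneg (|f₁ s| - √μ), abs_nonneg (f₁ s), sq_nonneg (|f₁ s|)]
  have hσf : ∀ s ∈ Icc 0 δ, |f₂ s| = σ * f₂ s := by
    intro s hs
    have h : 0 ≤ σ * f₂ s := hμ.le.trans (hlow s hs)
    rw [← abs_of_nonneg h, abs_mul, hσ, one_mul]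
  have hw'le : ∀ s ∈ Icc 0 δ, |w' s| ≤ σ * f₂ s / (μ + f₁ s ^ 2) := by
    intro s hs
    simp only [hw']
    rw [← hσf s hs, abs_div, abs_mul, abs_of_pos (pow_pos (hpos s) 2),
      div_le_div_iff₀ (pow_pos (hpos s) 2) (hpos s)]
    have h1 : |μ - f₁ s ^ 2| ≤ μ + f₁ s ^ 2 := by
      rw [abs_le]; constructor <;> nlinarith [sq_nonneg (f₁ s)]
    have h2 : 0 ≤ |f₂ s| * (μ + f₁ s ^ 2) := by have := hpos s; positivity
    nlinarith [mul_le_mul_of_nonneg_left h1 h2]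
  -- `U` has derivative `exp (I f) f₁ w ψ + B + D`, and `exp (I f) f₁ w ψ = exp (I f) ψ - A`.
  set U : ℝ → ℂ := fun s => -Complex.I * Complex.exp (Complex.I * f s) * (w s * ψ s) with hU
  set A : ℝ → ℂ := fun s => Complex.exp (Complex.I * f s) * ((μ / (μ + f₁ s ^ 2) : ℝ) * ψ s)
  set B : ℝ → ℂ := fun s => Complex.I * Complex.exp (Complex.I * f s) * (w' s * ψ s)
  set D : ℝ → ℂ := fun s => Complex.I * Complex.exp (Complex.I * f s) * (w s * ψ' s)
  have hcq : Continuous fun s => μ / (μ + f₁ s ^ 2) := by fun_prop (disch := assumption)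
  have hcA : Continuous A := by fun_prop
  have hcB : Continuous B := by fun_prop
  have hcD : Continuous D := by fun_prop
  set U' : ℝ → ℂ := fun s => Complex.exp (Complex.I * f s) * ψ s - A s - B s - D s with hU'
  have hcU' : Continuous U' := by fun_prop
  have hUder : ∀ s, HasDerivAt U (U' s) s := by
    intro s
    have he : HasDerivAt (fun s => Complex.exp (Complex.I * f s))
        (Complex.exp (Complex.I * f s) * (Complex.I * f₁ s)) s :=
      (((hf s).ofReal_comp).const_mul Complex.I).cexp
    have h := (he.const_mul (-Complex.I)).mul (((hwder s).ofReal_comp).mul (hψ s))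
    refine h.congr_deriv ?_
    have h1 : ((μ / (μ + f₁ s ^ 2) : ℝ) : ℂ) = 1 - f₁ s * w s := by
      rw [← Complex.ofReal_mul, ← Complex.ofReal_one, ← Complex.ofReal_sub]
      congr 1
      simp only [hw]
      have := hne s
      field_simp
      ring
    simp only [hU', A, B, D, h1, Pi.mul_apply]
    linear_combination (-Complex.exp (Complex.I * f s) * f₁ s * w s * ψ s) * Complex.I_sq
  have hsplit : ∫ s in (0)..δ, Complex.exp (Complex.I * f s) * ψ s =
      (U δ - U 0) + (∫ s in (0)..δ, A s) + (∫ s in (0)..δ, B s) + ∫ s in (0)..δ, D s := by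
    have hcF : Continuous fun s => Complex.exp (Complex.I * f s) * ψ s := by fun_prop
    have h := intervalIntegral.integral_eq_sub_of_hasDerivAt (fun s _ => hUder s)
      (hcU'.intervalIntegrable 0 δ)
    simp only [hU'] at h
    rw [intervalIntegral.integral_sub
        (Continuous.intervalIntegrable (by fun_prop) _ _) (hcD.intervalIntegrable _ _),
      intervalIntegral.integral_sub
        (Continuous.intervalIntegrable (by fun_prop) _ _) (hcB.intervalIntegrable _ _),
      intervalIntegral.integral_sub (hcF.intervalIntegrable _ _)
        (hcA.intervalIntegrable _ _)] at h
    rw [← h]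
    ring
  have hUle : ∀ s ∈ Icc 0 δ, ‖U s‖ ≤ 1 / √μ * M := by
    intro s hs
    simp only [hU, norm_mul, norm_neg, Complex.norm_I, hnorm, one_mul, Complex.norm_real,
      Real.norm_eq_abs]
    gcongr
    · exact hwle s
    · exact hM s hs
  have hcg : Continuous fun s => σ * f₂ s / (μ + f₁ s ^ 2) := by fun_prop (disch := assumption)
  have hgint := integral_deriv_div_le_pi_div_sqrt (δ := δ) hμ hσ hf₁ hf₂
  have hAle : ‖∫ s in (0)..δ, A s‖ ≤ M * (Real.pi / √μ) := by
    refine (intervalIntegral.norm_integral_le_of_norm_le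
      (g := fun s => M * (σ * f₂ s / (μ + f₁ s ^ 2))) hδ ?_
      ((hcg.const_mul M).intervalIntegrable _ _)).trans ?_
    · refine Filter.Eventually.of_forall fun s hs => ?_
      have hs' : s ∈ Icc 0 δ := ⟨hs.1.le, hs.2⟩
      simp only [A, norm_mul, hnorm, one_mul, Complex.norm_real, Real.norm_eq_abs]
      rw [abs_of_pos (div_pos hμ (hpos s)), mul_comm M]
      have h1 := hpos s
      have h2 := hlow s hs'
      exact mul_le_mul (by gcongr) (hM s hs') (norm_nonneg _)
        (div_nonneg (hμ.le.trans h2) h1.le)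
    · rw [intervalIntegral.integral_const_mul]; gcongr
  have hBle : ‖∫ s in (0)..δ, B s‖ ≤ M * (Real.pi / √μ) := by
    refine (intervalIntegral.norm_integral_le_of_norm_le
      (g := fun s => M * (σ * f₂ s / (μ + f₁ s ^ 2))) hδ ?_
      ((hcg.const_mul M).intervalIntegrable _ _)).trans ?_
    · refine Filter.Eventually.of_forall fun s hs => ?_
      have hs' : s ∈ Icc 0 δ := ⟨hs.1.le, hs.2⟩
      simp only [B, norm_mul, hnorm, one_mul, Complex.norm_real, Real.norm_eq_abs, Complex.norm_I]
      rw [mul_comm M]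
      exact mul_le_mul (hw'le s hs') (hM s hs') (norm_nonneg _)
        ((abs_nonneg _).trans (hw'le s hs'))
    · rw [intervalIntegral.integral_const_mul]; gcongr
  have hDle : ‖∫ s in (0)..δ, D s‖ ≤ 1 / √μ * ∫ s in (0)..δ, ‖ψ' s‖ := by
    rw [← intervalIntegral.integral_const_mul]
    refine intervalIntegral.norm_integral_le_of_norm_le hδ ?_
      ((hψ'.norm.const_mul (1 / √μ)).intervalIntegrable _ _)
    refine Filter.Eventually.of_forall fun s hs => ?_
    simp only [D, norm_mul, hnorm, one_mul, Complex.norm_real, Real.norm_eq_abs, Complex.norm_I]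
    gcongr
    exact hwle s
  have hI : 0 ≤ ∫ s in (0)..δ, ‖ψ' s‖ :=
    intervalIntegral.integral_nonneg hδ fun s _ => norm_nonneg _
  have hπ : Real.pi ≤ 3.15 := Real.pi_lt_d2.le.trans (by norm_num)
  rw [hsplit]
  calc _ ≤ (‖U δ‖ + ‖U 0‖) + ‖∫ s in (0)..δ, A s‖ + ‖∫ s in (0)..δ, B s‖
        + ‖∫ s in (0)..δ, D s‖ := by
        refine (norm_add_le _ _).trans ?_
        gcongr
        refine (norm_add_le _ _).trans ?_
        gcongr
        refine (norm_add_le _ _).trans ?_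
        gcongr
        exact norm_sub_le _ _
    _ ≤ (1 / √μ * M + 1 / √μ * M) + M * (Real.pi / √μ) + M * (Real.pi / √μ)
        + 1 / √μ * ∫ s in (0)..δ, ‖ψ' s‖ := by
        have := hUle δ ⟨hδ, le_rfl⟩
        have := hUle 0 ⟨le_rfl, hδ⟩
        gcongr
    _ = ((2 + 2 * Real.pi) * M + ∫ s in (0)..δ, ‖ψ' s‖) / √μ := by ring
    _ ≤ (9 * M + 9 * ∫ s in (0)..δ, ‖ψ' s‖) / √μ := by
        gcongr
        · linarith
        · linarith
    _ = _ := by ring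

theorem norm_le_integral_add_integral_deriv {ψ ψ' : ℝ → ℂ} {δ : ℝ} (hδ : 0 < δ)
    (hψ : ∀ s, HasDerivAt ψ (ψ' s) s) (hψ' : Continuous ψ') :
    ∀ s ∈ Icc 0 δ, ‖ψ s‖ ≤ δ⁻¹ * (∫ r in (0)..δ, ‖ψ r‖) + ∫ r in (0)..δ, ‖ψ' r‖ := by
  intro s hs
  have hcψ : Continuous ψ := continuous_iff_continuousAt.2 fun s => (hψ s).continuousAt
  have key : ∀ r ∈ Icc 0 δ, ‖ψ s‖ ≤ ‖ψ r‖ + ∫ u in (0)..δ, ‖ψ' u‖ := by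
    intro r hr
    have h1 : ψ s - ψ r = ∫ u in r..s, ψ' u :=
      (intervalIntegral.integral_eq_sub_of_hasDerivAt (fun u _ => hψ u) (hψ'.intervalIntegrable _ _)).symm
    have h2 : ‖ψ s - ψ r‖ ≤ ∫ u in (0)..δ, ‖ψ' u‖ := by
      rw [h1, intervalIntegral.integral_of_le hδ.le]
      refine intervalIntegral.norm_integral_le_integral_norm_uIoc.trans ?_
      refine setIntegral_mono_set ?_ (Filter.Eventually.of_forall fun _ => norm_nonneg _) ?_
      · exact (intervalIntegrable_iff_integrableOn_Ioc_of_le hδ.le).1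
          (hψ'.norm.intervalIntegrable _ _)
      · refine LE.le.eventuallyLE ?_
        exact Ioc_subset_Ioc (le_min hr.1 hs.1) (max_le hr.2 hs.2)
    calc ‖ψ s‖ = ‖ψ r + (ψ s - ψ r)‖ := by rw [add_sub_cancel]
      _ ≤ _ := (norm_add_le _ _).trans (by gcongr)
  have h := intervalIntegral.integral_mono_on (f := fun _ => ‖ψ s‖) (μ := volume) hδ.le
    (continuous_const.intervalIntegrable _ _)
    ((hcψ.norm.add continuous_const).intervalIntegrable _ _) key
  simp only [Pi.add_apply] at h
  rw [intervalIntegral.integral_const, intervalIntegral.integral_add (hcψ.norm.intervalIntegrable _ _)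
      (continuous_const.intervalIntegrable _ _), intervalIntegral.integral_const,
    smul_eq_mul, smul_eq_mul, sub_zero] at h
  rw [← mul_le_mul_iff_right₀ hδ, mul_add, mul_inv_cancel_left₀ hδ.ne']
  exact h

section Torus

variable {d : ℕ}

/-! ### Periodic functions and averaging over segments -/

/-- `2π`-periodicity in every coordinate, for functions with values in any type. -/
def IsTorusPeriodic {E : Type*} (F : (Fin d → ℝ) → E) : Prop :=
  ∀ (k : Fin d → ℝ) (j : Fin d), F (k + Pi.single j (2 * Real.pi)) = F k

/-- The period lattice `(2πℤ)^d`. -/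
noncomputable def periodLattice (d : ℕ) : AddSubgroup (Fin d → ℝ) :=
  AddSubgroup.pi univ fun _ => AddSubgroup.zmultiples (2 * Real.pi)

lemma IsTorusPeriodic.add_mem {E : Type*} {F : (Fin d → ℝ) → E} (hF : IsTorusPeriodic F)
    {g : Fin d → ℝ} (hg : g ∈ periodLattice d) (k : Fin d → ℝ) : F (k + g) = F k := by
  have hint : ∀ (j : Fin d) (n : ℤ) (k : Fin d → ℝ),
      F (k + Pi.single j (n • (2 * Real.pi))) = F k := by
    intro j n
    have hp : ∀ k, Function.Periodic
        (fun r : ℝ => F (k + Pi.single (M := fun _ => ℝ) j r)) (2 * Real.pi) := by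
      intro k r
      simp only [Pi.single_add, ← add_assoc]
      exact hF _ j
    intro k
    have := (hp k).zsmul n 0
    simpa using this
  have hsum : ∀ (s : Finset (Fin d)) (k : Fin d → ℝ), F (k + ∑ j ∈ s, Pi.single j (g j)) = F k := by
    intro s
    induction s using Finset.induction_on with
    | empty => simp
    | insert a s ha ih =>
      intro k
      obtain ⟨n, hn⟩ := hg a (mem_univ a)
      rw [Finset.sum_insert ha, ← add_assoc, ih, ← hn]
      exact hint a n k
  have := hsum Finset.univ k
  rwa [Finset.univ_sum_single] at this

instance : Countable (periodLattice d) := by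
  have : Function.Injective fun (g : periodLattice d) (j : Fin d) =>
      (⟨g.1 j, g.2 j (mem_univ j)⟩ : AddSubgroup.zmultiples (2 * Real.pi)) := by
    intro g h hgh
    ext j
    exact congrArg Subtype.val (congrFun hgh j)
  have h : Countable (AddSubgroup.zmultiples (2 * Real.pi)) := by
    refine Function.Surjective.countable (f := fun n : ℤ =>
      (⟨n • (2 * Real.pi), n, rfl⟩ : AddSubgroup.zmultiples (2 * Real.pi))) ?_
    rintro ⟨_, n, rfl⟩
    exact ⟨n, rfl⟩
  exact Function.Injective.countable this

lemma isAddFundamentalDomain_box (a : Fin d → ℝ) :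
    IsAddFundamentalDomain (periodLattice d)
      (univ.pi fun j => Ioc (a j) (a j + 2 * Real.pi)) volume := by
  refine IsAddFundamentalDomain.mk'
    (MeasurableSet.univ_pi fun _ => measurableSet_Ioc).nullMeasurableSet fun x => ?_
  have h := fun j => existsUnique_add_zsmul_mem_Ioc Real.two_pi_pos (x j) (a j)
  choose n hn hu using h
  refine ⟨⟨fun j => n j • (2 * Real.pi), fun j _ => ⟨n j, rfl⟩⟩, ?_, ?_⟩
  · intro j _
    change n j • (2 * Real.pi) + x j ∈ _
    rw [add_comm]
    exact hn j
  · rintro ⟨g, hg⟩ hgx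
    ext j
    obtain ⟨m, hm⟩ := hg j (mem_univ j)
    have hm' : m • (2 * Real.pi) = g j := hm
    have h2 : x j + m • (2 * Real.pi) ∈ Ioc (a j) (a j + 2 * Real.pi) := by
      have := hgx j (mem_univ j)
      change g j + x j ∈ _ at this
      rwa [hm', add_comm (x j)]
    have := hu j m h2
    simp only
    rw [← hm', this]

lemma torusBox_eq : torusBox d = univ.pi fun _ => Ioc (-Real.pi) (-Real.pi + 2 * Real.pi) := by
  unfold torusBox
  congr! 3
  ring

lemma measurableSet_torusBox : MeasurableSet (torusBox d) :=
  MeasurableSet.univ_pi fun _ => measurableSet_Ioc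

/-- The closed box `[-π, π]^d`, a compact set containing `torusBox d`. -/
def closedTorusBox (d : ℕ) : Set (Fin d → ℝ) := univ.pi fun _ => Icc (-Real.pi) Real.pi

lemma isCompact_closedTorusBox : IsCompact (closedTorusBox d) :=
  isCompact_univ_pi fun _ => isCompact_Icc

lemma torusBox_subset : torusBox d ⊆ closedTorusBox d := pi_mono fun _ _ => Ioc_subset_Icc_self

lemma IsTorusPeriodic.exists_mem_closedTorusBox {E : Type*} {F : (Fin d → ℝ) → E}
    (hF : IsTorusPeriodic F) (k : Fin d → ℝ) : ∃ k' ∈ closedTorusBox d, F k = F k' := by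
  have h := fun j => existsUnique_add_zsmul_mem_Ioc Real.two_pi_pos (k j) (-Real.pi)
  choose n hn _ using h
  refine ⟨k + fun j => n j • (2 * Real.pi), torusBox_subset ?_, (hF.add_mem ?_ k).symm⟩
  · rw [torusBox_eq]
    exact fun j _ => hn j
  · exact fun j _ => ⟨n j, rfl⟩

lemma integrableOn_torusBox {E : Type*} [NormedAddCommGroup E] {F : (Fin d → ℝ) → E}
    (hF : Continuous F) : IntegrableOn F (torusBox d) :=
  (hF.continuousOn.integrableOn_compact isCompact_closedTorusBox).mono_set torusBox_subset

/-- A translate of the box is again a fundamental domain of the period lattice, so integrals over the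
torus are translation invariant. -/
lemma IsTorusPeriodic.setIntegral_add {E : Type*} [NormedAddCommGroup E] [NormedSpace ℝ E]
    {F : (Fin d → ℝ) → E}
    (hF : IsTorusPeriodic F) (y : Fin d → ℝ) :
    ∫ k in torusBox d, F (k + y) = ∫ k in torusBox d, F k := by
  have hmp : MeasurePreserving (fun k : Fin d → ℝ => k + y) volume volume :=
    measurePreserving_add_right volume y
  have hemb : MeasurableEmbedding (fun k : Fin d → ℝ => k + y) := measurableEmbedding_addRight y
  have hpre : torusBox d = (fun k : Fin d → ℝ => k + y) ⁻¹'
      (univ.pi fun j => Ioc (-Real.pi + y j) (-Real.pi + y j + 2 * Real.pi)) := by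
    ext k
    simp only [torusBox, mem_univ_pi, mem_preimage, Pi.add_apply, mem_Ioc]
    refine forall_congr' fun j => ?_
    constructor <;> rintro ⟨h1, h2⟩ <;> constructor <;> linarith
  have h1 := hmp.setIntegral_preimage_emb hemb F
    (univ.pi fun j => Ioc (-Real.pi + y j) (-Real.pi + y j + 2 * Real.pi))
  rw [← hpre] at h1
  rw [h1, torusBox_eq]
  refine (isAddFundamentalDomain_box _).setIntegral_eq (isAddFundamentalDomain_box _) fun g x => ?_
  have := hF.add_mem g.2 x
  rw [AddSubgroup.vadd_def, vadd_eq_add, add_comm]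
  exact this

lemma integrable_prod_torusBox {E : Type*} [NormedAddCommGroup E] {F : (Fin d → ℝ) → E}
    (hF : Continuous F) (v : Fin d → ℝ) (δ : ℝ) :
    Integrable (Function.uncurry fun (k : Fin d → ℝ) (s : ℝ) => F (k + s • v))
      ((volume.restrict (torusBox d)).prod (volume.restrict (Ioc 0 δ))) := by
  rw [Measure.prod_restrict]
  have hc : Continuous (Function.uncurry fun (k : Fin d → ℝ) (s : ℝ) => F (k + s • v)) := by
    unfold Function.uncurry; fun_prop
  exact (hc.continuousOn.integrableOn_compact
    (isCompact_closedTorusBox.prod isCompact_Icc)).mono_set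
      (prod_mono torusBox_subset Ioc_subset_Icc_self)

/-- An integral over the torus is the average of the integrals over the segments
`k + [0, δ] v`. This reduces estimates on the torus to estimates on segments in an arbitrary
direction, without adapting the coordinates to that direction. -/
theorem IsTorusPeriodic.smul_setIntegral_eq {E : Type*} [NormedAddCommGroup E]
    [NormedSpace ℝ E] [CompleteSpace E] {F : (Fin d → ℝ) → E} (hF : IsTorusPeriodic F)
    (hc : Continuous F) (v : Fin d → ℝ) {δ : ℝ} (hδ : 0 ≤ δ) :
    ∫ k in torusBox d, ∫ s in (0)..δ, F (k + s • v) = δ • ∫ k in torusBox d, F k := by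
  simp only [intervalIntegral.integral_of_le hδ]
  rw [integral_integral_swap (integrable_prod_torusBox hc v δ)]
  have h : ∀ s : ℝ, ∫ k in torusBox d, F (k + s • v) = ∫ k in torusBox d, F k :=
    fun s => hF.setIntegral_add _
  simp [h, hδ]

lemma integrableOn_torusBox_intervalIntegral {E : Type*} [NormedAddCommGroup E]
    [NormedSpace ℝ E] {F : (Fin d → ℝ) → E}
    (hc : Continuous F) (v : Fin d → ℝ) {δ : ℝ} (hδ : 0 ≤ δ) :
    IntegrableOn (fun k => ∫ s in (0)..δ, F (k + s • v)) (torusBox d) := by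
  simp only [intervalIntegral.integral_of_le hδ]
  exact (integrable_prod_torusBox hc v δ).integral_prod_left

end Torus

section Dispersion

variable {d : ℕ} {ω : ℝ} {lam : Fin d → ℝ}

/-! ### Directional derivatives of the dispersion relation -/

/-- The first derivative of `γ` at `k` in the direction `v`, in closed form. -/
noncomputable def gamDir (ω : ℝ) (lam v k : Fin d → ℝ) : ℝ :=
  (∑ j, lam j * v j * Real.sin (k j)) / gam ω lam k

/-- The second derivative of `γ` at `k` in the direction `v`, in closed form. -/
noncomputable def gamDir₂ (ω : ℝ) (lam v k : Fin d → ℝ) : ℝ :=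
  (∑ j, lam j * v j ^ 2 * Real.cos (k j)) / gam ω lam k
    - (∑ j, lam j * v j * Real.sin (k j)) ^ 2 / gam ω lam k ^ 3

lemma radicand_pos (hω : 0 < ω) (hlam : ∀ j, 0 < lam j) (k : Fin d → ℝ) :
    0 < ω ^ 2 + 4 * ∑ j, lam j * Real.sin (k j / 2) ^ 2 := by
  have : 0 ≤ ∑ j, lam j * Real.sin (k j / 2) ^ 2 :=
    Finset.sum_nonneg fun j _ => mul_nonneg (hlam j).le (sq_nonneg _)
  positivity

lemma gam_pos (hω : 0 < ω) (hlam : ∀ j, 0 < lam j) (k : Fin d → ℝ) : 0 < gam ω lam k :=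
  Real.sqrt_pos.2 (radicand_pos hω hlam k)

lemma contDiff_gam (hω : 0 < ω) (hlam : ∀ j, 0 < lam j) : ContDiff ℝ 1 (gam (d := d) ω lam) := by
  unfold gam
  exact ContDiff.sqrt (by fun_prop) fun k => (radicand_pos hω hlam k).ne'

lemma contDiff_gamDir₂ (hω : 0 < ω) (hlam : ∀ j, 0 < lam j) (v : Fin d → ℝ) :
    ContDiff ℝ 1 (gamDir₂ ω lam v) := by
  have h := contDiff_gam hω hlam
  have h0 : ∀ k, gam ω lam k ≠ 0 := fun k => (gam_pos hω hlam k).ne'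
  have h3 : ∀ k, gam ω lam k ^ 3 ≠ 0 := fun k => pow_ne_zero 3 (h0 k)
  unfold gamDir₂
  exact (ContDiff.div (by fun_prop) h h0).sub (ContDiff.div (by fun_prop) (h.pow 3) h3)

lemma isTorusPeriodic_gam : IsTorusPeriodic (gam (d := d) ω lam) := by
  intro k j
  unfold gam
  congr 3
  refine Finset.sum_congr rfl fun i _ => ?_
  rcases eq_or_ne i j with rfl | h
  · rw [Pi.add_apply, Pi.single_eq_same, add_div, mul_div_cancel_left₀ _ two_ne_zero,
      Real.sin_add_pi, neg_sq]
  · rw [Pi.add_apply, Pi.single_eq_of_ne h, add_zero]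

lemma isTorusPeriodic_gamDir₂ (v : Fin d → ℝ) : IsTorusPeriodic (gamDir₂ ω lam v) := by
  intro k j
  have hs : ∀ i, Real.sin ((k + Pi.single j (2 * Real.pi) : Fin d → ℝ) i) = Real.sin (k i) := by
    intro i
    rcases eq_or_ne i j with rfl | h
    · rw [Pi.add_apply, Pi.single_eq_same, Real.sin_add_two_pi]
    · rw [Pi.add_apply, Pi.single_eq_of_ne h, add_zero]
  have hc : ∀ i, Real.cos ((k + Pi.single j (2 * Real.pi) : Fin d → ℝ) i) = Real.cos (k i) := by
    intro i
    rcases eq_or_ne i j with rfl | h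
    · rw [Pi.add_apply, Pi.single_eq_same, Real.cos_add_two_pi]
    · rw [Pi.add_apply, Pi.single_eq_of_ne h, add_zero]
  simp only [gamDir₂, hs, hc, isTorusPeriodic_gam k j]

lemma isTorusPeriodic_exp_phase (t : ℝ) (x : Fin d → ℤ) :
    IsTorusPeriodic fun k => Complex.exp (Complex.I * (phase ω lam t x k : ℂ)) := by
  intro k j
  have h : phase ω lam t x (k + Pi.single j (2 * Real.pi)) =
      phase ω lam t x k + x j * (2 * Real.pi) := by
    simp only [phase, isTorusPeriodic_gam k j, Pi.add_apply, add_mul, Finset.sum_add_distrib]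
    rw [Finset.sum_eq_single (s := Finset.univ)
      (f := fun i => (Pi.single j (2 * Real.pi) : Fin d → ℝ) i * (x i : ℝ)) j
      (fun i _ hi => by rw [Pi.single_eq_of_ne hi, zero_mul]) (by simp), Pi.single_eq_same]
    ring
  have h' : Complex.I * ((phase ω lam t x k + x j * (2 * Real.pi) : ℝ) : ℂ) =
      Complex.I * (phase ω lam t x k : ℂ) + (x j : ℤ) * (2 * Real.pi * Complex.I) := by
    push_cast
    ring
  simp only [h, h']
  exact Complex.exp_periodic.int_mul (x j) _

lemma hasDerivAt_line_apply (k v : Fin d → ℝ) (j : Fin d) (s : ℝ) :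
    HasDerivAt (fun s : ℝ => (k + s • v) j) (v j) s := by
  simpa using ((hasDerivAt_id s).mul_const (v j)).const_add (k j)

lemma hasDerivAt_gam_line (hω : 0 < ω) (hlam : ∀ j, 0 < lam j) (k v : Fin d → ℝ) (s : ℝ) :
    HasDerivAt (fun s : ℝ => gam ω lam (k + s • v)) (gamDir ω lam v (k + s • v)) s := by
  have hj : ∀ j, HasDerivAt (fun s : ℝ => lam j * Real.sin ((k + s • v) j / 2) ^ 2)
      (lam j * v j * Real.sin ((k + s • v) j) / 2) s := by
    intro j
    have h := ((((hasDerivAt_line_apply k v j s).div_const 2).sin).fun_pow 2).const_mul (lam j)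
    refine h.congr_deriv ?_
    have h2 : (k + s • v) j = 2 * ((k + s • v) j / 2) := by ring
    rw [h2, Real.sin_two_mul, ← h2]
    push_cast
    ring
  have hsum := HasDerivAt.fun_sum (u := (Finset.univ : Finset (Fin d))) fun j _ => hj j
  have h := ((hsum.const_mul 4).const_add (ω ^ 2)).sqrt (radicand_pos hω hlam _).ne'
  refine h.congr_deriv ?_
  unfold gamDir gam
  rw [← Finset.sum_div, show ∀ a b : ℝ, 4 * (a / 2) / (2 * b) = a / b from fun a b => by ring]

lemma hasDerivAt_gamDir_line (hω : 0 < ω) (hlam : ∀ j, 0 < lam j) (k v : Fin d → ℝ) (s : ℝ) :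
    HasDerivAt (fun s : ℝ => gamDir ω lam v (k + s • v)) (gamDir₂ ω lam v (k + s • v)) s := by
  have hj : ∀ j, HasDerivAt (fun s : ℝ => lam j * v j * Real.sin ((k + s • v) j))
      (lam j * v j * (Real.cos ((k + s • v) j) * v j)) s := fun j =>
    ((hasDerivAt_line_apply k v j s).sin).const_mul (lam j * v j)
  have hsum := HasDerivAt.fun_sum (u := (Finset.univ : Finset (Fin d))) fun j _ => hj j
  have h0 := (gam_pos hω hlam (k + s • v)).ne'
  have h := hsum.div (hasDerivAt_gam_line hω hlam k v s) h0
  refine h.congr_deriv ?_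
  have h1 : ∑ j, lam j * v j * (Real.cos ((k + s • v) j) * v j) =
      ∑ j, lam j * v j ^ 2 * Real.cos ((k + s • v) j) :=
    Finset.sum_congr rfl fun j _ => by ring
  rw [h1]
  unfold gamDir gamDir₂
  field_simp

lemma gamDir₂_eq_zero_iff (hω : 0 < ω) (hlam : ∀ j, 0 < lam j) (v k : Fin d → ℝ) :
    gamDir₂ ω lam v k = 0 ↔
      (∑ j, lam j * v j ^ 2 * Real.cos (k j)) * gam ω lam k ^ 2 =
        (∑ j, lam j * v j * Real.sin (k j)) ^ 2 := by
  have h0 := (gam_pos hω hlam k).ne'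
  unfold gamDir₂
  rw [sub_eq_zero, div_eq_div_iff h0 (pow_ne_zero 3 h0)]
  constructor
  · intro h
    apply mul_right_cancel₀ h0
    rw [← h]; ring
  · intro h
    rw [← h]; ring

/-- The Hessian of `γ` vanishes nowhere in dimension at least two. If the three second derivatives
vanished, polarization would give `λ_a sin k_a λ_b sin k_b = 0`; but when `sin k_i = 0`, the vanishing
of the second derivative in the direction `i` forces `cos k_i = 0` as well. -/
lemma exists_gamDir₂_ne_zero (hω : 0 < ω) (hlam : ∀ j, 0 < lam j) {a b : Fin d} (hab : a ≠ b)
    (k : Fin d → ℝ) :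
    gamDir₂ ω lam (Pi.single a 1) k ≠ 0 ∨ gamDir₂ ω lam (Pi.single b 1) k ≠ 0 ∨
      gamDir₂ ω lam (Pi.single a 1 + Pi.single b 1) k ≠ 0 := by
  by_contra! h
  obtain ⟨ha, hb, hc⟩ := h
  rw [gamDir₂_eq_zero_iff hω hlam] at ha hb hc
  have h1 : ∀ (i : Fin d) (f : Fin d → ℝ),
      ∑ j, lam j * (Pi.single i 1 : Fin d → ℝ) j * f j = lam i * f i := by
    intro i f
    rw [Finset.sum_eq_single i (fun j _ hj => by rw [Pi.single_eq_of_ne hj]; ring) (by simp),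
      Pi.single_eq_same, mul_one]
  have h2 : ∀ (i : Fin d) (f : Fin d → ℝ),
      ∑ j, lam j * (Pi.single i 1 : Fin d → ℝ) j ^ 2 * f j = lam i * f i := by
    intro i f
    rw [Finset.sum_eq_single i (fun j _ hj => by rw [Pi.single_eq_of_ne hj]; ring) (by simp),
      Pi.single_eq_same, one_pow, mul_one]
  have h3 : ∀ j, (Pi.single a 1 + Pi.single b 1 : Fin d → ℝ) j ^ 2 =
      (Pi.single a 1 : Fin d → ℝ) j ^ 2 + (Pi.single b 1 : Fin d → ℝ) j ^ 2 := by
    intro j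
    have : (Pi.single a 1 : Fin d → ℝ) j * (Pi.single b 1 : Fin d → ℝ) j = 0 := by
      rcases eq_or_ne j a with rfl | hj
      · rw [Pi.single_eq_of_ne hab, mul_zero]
      · rw [Pi.single_eq_of_ne hj, zero_mul]
    rw [Pi.add_apply]
    linear_combination 2 * this
  simp only [h3] at hc
  simp only [Pi.add_apply, mul_add, add_mul, Finset.sum_add_distrib, h1, h2] at ha hb hc
  have hγ : gam ω lam k ^ 2 ≠ 0 := pow_ne_zero 2 (gam_pos hω hlam k).ne'
  have hmul : lam a * Real.sin (k a) * (lam b * Real.sin (k b)) = 0 := by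
    linear_combination (ha + hb - hc) / 2
  have hno : ∀ i : Fin d, lam i * Real.sin (k i) = 0 →
      lam i * Real.cos (k i) * gam ω lam k ^ 2 = (lam i * Real.sin (k i)) ^ 2 → False := by
    intro i hs hcos
    rw [hs, zero_pow two_ne_zero] at hcos
    have hs' : Real.sin (k i) = 0 := (mul_eq_zero.1 hs).resolve_left (hlam i).ne'
    have hc' : Real.cos (k i) = 0 :=
      (mul_eq_zero.1 ((mul_eq_zero.1 hcos).resolve_right hγ)).resolve_left (hlam i).ne'
    have := Real.sin_sq_add_cos_sq (k i)
    rw [hs', hc'] at this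
    norm_num at this
  rcases mul_eq_zero.1 hmul with h | h
  · exact hno a h ha
  · exact hno b h hb

/-! ### Amplitudes supported where one second derivative is large -/

lemma IsC1Torus.isTorusPeriodic_fderiv {η : (Fin d → ℝ) → ℂ} (hη : IsC1Torus η) (v : Fin d → ℝ) :
    IsTorusPeriodic fun k => fderiv ℝ η k v := by
  intro k j
  have h : (fun k => η (k + Pi.single j (2 * Real.pi))) = η := funext fun k => hη.2 k j
  simp only
  rw [← fderiv_comp_add_right, h]

/-- By uniform continuity there is some `δ ≤ 1` such that `|g|` cannot fall below `c / 2`, nor `g`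
change sign, on a segment `k + [0, δ] v` containing a point with `c ≤ |g|`. -/
lemma exists_segment_lower_bound {g : (Fin d → ℝ) → ℝ} (hg : Continuous g) (v : Fin d → ℝ) {c : ℝ}
    (hc : 0 < c) :
    ∃ δ : ℝ, 0 < δ ∧ δ ≤ 1 ∧ ∀ k ∈ torusBox d, ∀ s ∈ Icc 0 δ, c ≤ |g (k + s • v)| →
      ∃ σ : ℝ, |σ| = 1 ∧ ∀ r ∈ Icc 0 δ, c / 2 ≤ σ * g (k + r • v) := by
  have hK : IsCompact (closedTorusBox d ×ˢ Icc (0 : ℝ) 1) :=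
    isCompact_closedTorusBox.prod isCompact_Icc
  have hcont : Continuous fun p : (Fin d → ℝ) × ℝ => g (p.1 + p.2 • v) := by fun_prop
  obtain ⟨ε, hε, h⟩ := Metric.uniformContinuousOn_iff.1
    (hK.uniformContinuousOn_of_continuous hcont.continuousOn) (c / 2) (by positivity)
  refine ⟨min 1 (ε / 2), by positivity, min_le_left _ _, fun k hk s hs hgs => ?_⟩
  have hmem : ∀ r ∈ Icc 0 (min 1 (ε / 2)), (k, r) ∈ closedTorusBox d ×ˢ Icc (0 : ℝ) 1 :=
    fun r hr => ⟨torusBox_subset hk, hr.1, hr.2.trans (min_le_left _ _)⟩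
  have hclose : ∀ r ∈ Icc 0 (min 1 (ε / 2)), |g (k + r • v) - g (k + s • v)| < c / 2 := by
    intro r hr
    refine h _ (hmem r hr) _ (hmem s hs) ?_
    rw [Prod.dist_eq, dist_self, max_lt_iff, Real.dist_eq]
    refine ⟨hε, ?_⟩
    have h1 := hr.2.trans (min_le_right _ _)
    have h2 := hs.2.trans (min_le_right _ _)
    rw [abs_lt]
    constructor <;> linarith [hr.1, hs.1]
  rcases le_abs.1 hgs with hpos | hneg
  · refine ⟨1, abs_one, fun r hr => ?_⟩
    linarith [(abs_lt.1 (hclose r hr)).1]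
  · refine ⟨-1, by simp, fun r hr => ?_⟩
    linarith [(abs_lt.1 (hclose r hr)).2]

lemma norm_segment_integral_le (hω : 0 < ω) (hlam : ∀ j, 0 < lam j) {v : Fin d → ℝ}
    {c δ : ℝ} (hc : 0 < c) (hδ : 0 < δ) {η : (Fin d → ℝ) → ℂ} (hη : ContDiff ℝ 1 η)
    {k : Fin d → ℝ} {σ : ℝ} (hσ : |σ| = 1)
    (hlow : ∀ r ∈ Icc 0 δ, c ≤ σ * gamDir₂ ω lam v (k + r • v))
    (x : Fin d → ℤ) {t : ℝ} (ht : 0 < |t|) :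
    ‖∫ s in (0)..δ, Complex.exp (Complex.I * (phase ω lam t x (k + s • v) : ℂ)) * η (k + s • v)‖ ≤
      9 / √(2 * c * |t|) * (δ⁻¹ * (∫ s in (0)..δ, ‖η (k + s • v)‖) +
        2 * ∫ s in (0)..δ, ‖fderiv ℝ η (k + s • v) v‖) := by
  have hlin : ∀ s : ℝ, HasDerivAt (fun s : ℝ => ∑ j, (k + s • v) j * (x j : ℝ))
      (∑ j, v j * (x j : ℝ)) s := fun s =>
    HasDerivAt.fun_sum (u := (Finset.univ : Finset (Fin d))) fun j _ =>
      (hasDerivAt_line_apply k v j s).mul_const (x j : ℝ)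
  have hf : ∀ s : ℝ, HasDerivAt (fun s : ℝ => phase ω lam t x (k + s • v))
      (∑ j, v j * (x j : ℝ) - 2 * t * gamDir ω lam v (k + s • v)) s := fun s =>
    (hlin s).sub ((hasDerivAt_gam_line hω hlam k v s).const_mul (2 * t))
  have hf₁ : ∀ s : ℝ, HasDerivAt
      (fun s : ℝ => ∑ j, v j * (x j : ℝ) - 2 * t * gamDir ω lam v (k + s • v))
      (-(2 * t * gamDir₂ ω lam v (k + s • v))) s := fun s =>
    ((hasDerivAt_gamDir_line hω hlam k v s).const_mul (2 * t)).const_sub _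
  have hcg : Continuous (gamDir₂ ω lam v) := (contDiff_gamDir₂ hω hlam v).continuous
  have hf₂ : Continuous fun s : ℝ => -(2 * t * gamDir₂ ω lam v (k + s • v)) := by fun_prop
  have hψ : ∀ s : ℝ, HasDerivAt (fun s : ℝ => η (k + s • v)) (fderiv ℝ η (k + s • v) v) s := by
    intro s
    have hl : HasDerivAt (fun s : ℝ => k + s • v) v s := by
      simpa using ((hasDerivAt_id s).smul_const v).const_add k
    exact ((hη.differentiable one_ne_zero).differentiableAt.hasFDerivAt).comp_hasDerivAt s hl
  have hcD : Continuous fun k => fderiv ℝ η k v :=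
    (hη.continuous_fderiv one_ne_zero).clm_apply continuous_const
  have hψ' : Continuous fun s : ℝ => fderiv ℝ η (k + s • v) v := by fun_prop
  have htt : t / |t| * t = |t| := by
    rw [div_mul_eq_mul_div, div_eq_iff ht.ne', abs_mul_abs_self]
  have hσ' : |-(σ * (t / |t|))| = 1 := by
    rw [abs_neg, abs_mul, hσ, abs_div, abs_abs, div_self ht.ne', one_mul]
  refine (norm_oscillatory_integral_le hδ.le (μ := 2 * c * |t|) (by positivity) hσ' hf hf₁ hf₂ hψ
    hψ' (fun s hs => ?_) (norm_le_integral_add_integral_deriv hδ hψ hψ')).trans (le_of_eq (by ring))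
  have h1 : -(σ * (t / |t|)) * -(2 * t * gamDir₂ ω lam v (k + s • v)) =
      2 * |t| * (σ * gamDir₂ ω lam v (k + s • v)) := by
    linear_combination (2 * σ * gamDir₂ ω lam v (k + s • v)) * htt
  rw [h1]
  nlinarith [hlow s hs]

/-- The dispersive bound for amplitudes supported where the second derivative of `γ` in the direction
`v` is at least `c` in absolute value. The linear part `k · x` of the phase does not affect second
derivatives, whence the uniformity in `x`. -/
theorem exists_directional_bound (hω : 0 < ω) (hlam : ∀ j, 0 < lam j) (v : Fin d → ℝ) {c : ℝ}
    (hc : 0 < c) :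
    ∃ C : ℝ, 0 ≤ C ∧ ∀ η : (Fin d → ℝ) → ℂ, IsC1Torus η →
      (∀ k, η k ≠ 0 → c ≤ |gamDir₂ ω lam v k|) → ∀ (x : Fin d → ℤ) (t : ℝ), 1 ≤ |t| →
        ‖∫ k in torusBox d, Complex.exp (Complex.I * (phase ω lam t x k : ℂ)) * η k‖ ≤
          C / |t| ^ (1 / 2 : ℝ) * ((∫ k in torusBox d, ‖fderiv ℝ η k v‖) + torusL1 η) := by
  obtain ⟨δ, hδ, hδ1, hseg⟩ :=
    exists_segment_lower_bound (contDiff_gamDir₂ hω hlam v).continuous v hc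
  refine ⟨18 / (√c * δ), by positivity, fun η hη hsupp x t ht => ?_⟩
  have ht0 : 0 < |t| := one_pos.trans_le ht
  set F : (Fin d → ℝ) → ℂ :=
    fun k => Complex.exp (Complex.I * (phase ω lam t x k : ℂ)) * η k with hF
  have hcγ : Continuous (gam ω lam) := (contDiff_gam hω hlam).continuous
  have hcη : Continuous η := hη.1.continuous
  have hcF : Continuous F := by
    simp only [hF, phase]
    fun_prop
  have hcD : Continuous fun k => fderiv ℝ η k v :=
    (hη.1.continuous_fderiv one_ne_zero).clm_apply continuous_const
  have hperF : IsTorusPeriodic F := fun k j => by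
    have h := isTorusPeriodic_exp_phase (ω := ω) (lam := lam) t x k j
    simp only at h
    simp only [hF, hη.2 k j, h]
  have hperN : IsTorusPeriodic fun k => ‖η k‖ := fun k j => by simp only [hη.2 k j]
  have hperD : IsTorusPeriodic fun k => ‖fderiv ℝ η k v‖ := fun k j => by
    simp only [hη.isTorusPeriodic_fderiv v k j]
  have hcN : Continuous fun k => ‖η k‖ := hcη.norm
  have hcDN : Continuous fun k => ‖fderiv ℝ η k v‖ := hcD.norm
  set R : (Fin d → ℝ) → ℝ := fun k => 9 / √(2 * (c / 2) * |t|) *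
    (δ⁻¹ * (∫ s in (0)..δ, ‖η (k + s • v)‖) + 2 * ∫ s in (0)..δ, ‖fderiv ℝ η (k + s • v) v‖)
    with hR
  have hbound : ∀ k ∈ torusBox d, ‖∫ s in (0)..δ, F (k + s • v)‖ ≤ R k := by
    intro k hk
    by_cases h : ∃ s ∈ Icc 0 δ, η (k + s • v) ≠ 0
    · obtain ⟨s, hs, hs0⟩ := h
      obtain ⟨σ, hσ, hlow⟩ := hseg k hk s hs (hsupp _ hs0)
      exact norm_segment_integral_le hω hlam (by positivity) hδ hη.1 hσ hlow x ht0
    -- The amplitude vanishes on the whole segment.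
    · push Not at h
      have h0 : ∫ s in (0)..δ, F (k + s • v) = 0 := by
        refine intervalIntegral.integral_zero_ae (Filter.Eventually.of_forall fun s hs => ?_)
        rw [uIoc_of_le hδ.le] at hs
        simp only [hF, h s ⟨hs.1.le, hs.2⟩, mul_zero]
      rw [h0, norm_zero]
      have h1 : 0 ≤ ∫ s in (0)..δ, ‖η (k + s • v)‖ :=
        intervalIntegral.integral_nonneg hδ.le fun _ _ => norm_nonneg _
      have h2 : 0 ≤ ∫ s in (0)..δ, ‖fderiv ℝ η (k + s • v) v‖ :=
        intervalIntegral.integral_nonneg hδ.le fun _ _ => norm_nonneg _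
      simp only [hR]
      positivity
  have hiN := integrableOn_torusBox_intervalIntegral hcN v hδ.le
  have hiD := integrableOn_torusBox_intervalIntegral hcDN v hδ.le
  have hiR : IntegrableOn R (torusBox d) :=
    ((hiN.const_mul δ⁻¹).add (hiD.const_mul 2)).const_mul _
  have hRint : ∫ k in torusBox d, R k = 9 / √(2 * (c / 2) * |t|) *
      (torusL1 η + 2 * δ * ∫ k in torusBox d, ‖fderiv ℝ η k v‖) := by
    simp only [hR]
    rw [integral_const_mul, integral_add (hiN.const_mul δ⁻¹) (hiD.const_mul 2),
      integral_const_mul, integral_const_mul, hperN.smul_setIntegral_eq hcN v hδ.le,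
      hperD.smul_setIntegral_eq hcDN v hδ.le, smul_eq_mul, smul_eq_mul,
      inv_mul_cancel_left₀ hδ.ne', torusL1]
    ring
  have hmain : δ * ‖∫ k in torusBox d, F k‖ ≤ ∫ k in torusBox d, R k := by
    have h1 : δ * ‖∫ k in torusBox d, F k‖ =
        ‖∫ k in torusBox d, ∫ s in (0)..δ, F (k + s • v)‖ := by
      rw [hperF.smul_setIntegral_eq hcF v hδ.le, norm_smul, Real.norm_of_nonneg hδ.le]
    rw [h1]
    exact norm_integral_le_of_norm_le hiR
      ((ae_restrict_iff' measurableSet_torusBox).2 (Filter.Eventually.of_forall hbound))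
  have hL : 0 ≤ torusL1 η := integral_nonneg fun _ => norm_nonneg _
  have hDn : 0 ≤ ∫ k in torusBox d, ‖fderiv ℝ η k v‖ := integral_nonneg fun _ => norm_nonneg _
  have hsq : √(2 * (c / 2) * |t|) = √c * |t| ^ (1 / 2 : ℝ) := by
    rw [mul_div_cancel₀ _ two_ne_zero, Real.sqrt_mul hc.le, Real.sqrt_eq_rpow |t|]
  rw [hRint, hsq] at hmain
  have hp : 0 < |t| ^ (1 / 2 : ℝ) := by positivity
  have hcp : 0 < √c := Real.sqrt_pos.2 hc
  rw [← mul_le_mul_iff_right₀ hδ]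
  refine hmain.trans ?_
  have heq : δ * (18 / (√c * δ) / |t| ^ (1 / 2 : ℝ) *
      ((∫ k in torusBox d, ‖fderiv ℝ η k v‖) + torusL1 η)) =
      9 / (√c * |t| ^ (1 / 2 : ℝ)) *
        (2 * torusL1 η + 2 * ∫ k in torusBox d, ‖fderiv ℝ η k v‖) := by
    field_simp
    ring
  rw [heq]
  gcongr
  · linarith
  · nlinarith

/-! ### The partition of unity -/

lemma norm_fderiv_apply_le (η : (Fin d → ℝ) → ℂ) (k v : Fin d → ℝ) (hv : ∀ j, |v j| ≤ 1) :
    ‖fderiv ℝ η k v‖ ≤ ∑ j, ‖partialDeriv j η k‖ := by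
  have h : v = ∑ j, v j • (Pi.single j 1 : Fin d → ℝ) := by
    conv_lhs => rw [← Finset.univ_sum_single v]
    refine Finset.sum_congr rfl fun j _ => ?_
    rw [← Pi.single_smul, smul_eq_mul, mul_one]
  conv_lhs => rw [h]
  rw [map_sum]
  refine (norm_sum_le _ _).trans (Finset.sum_le_sum fun j _ => ?_)
  rw [map_smul, norm_smul, Real.norm_eq_abs]
  exact mul_le_of_le_one_left (norm_nonneg _) (hv j)

lemma torusL1_nonneg (η : (Fin d → ℝ) → ℂ) : 0 ≤ torusL1 η := integral_nonneg fun _ => norm_nonneg _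

lemma torusGradL1_nonneg (η : (Fin d → ℝ) → ℂ) : 0 ≤ torusGradL1 η :=
  integral_nonneg fun _ => Finset.sum_nonneg fun _ _ => norm_nonneg _

/-- The dispersive bound for the amplitude `χ η`, with `χ` a fixed weight supported where the second
derivative of `γ` in the direction `v` is bounded below. -/
theorem exists_weighted_bound (hω : 0 < ω) (hlam : ∀ j, 0 < lam j) {v : Fin d → ℝ}
    (hv : ∀ j, |v j| ≤ 1) {c : ℝ} (hc : 0 < c) {χ : (Fin d → ℝ) → ℝ} (hχ : ContDiff ℝ 1 χ)
    (hχper : IsTorusPeriodic χ) (hχ1 : ∀ k, |χ k| ≤ 1)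
    (hsupp : ∀ k, χ k ≠ 0 → c ≤ |gamDir₂ ω lam v k|) :
    ∃ C : ℝ, ∀ η : (Fin d → ℝ) → ℂ, IsC1Torus η → ∀ (x : Fin d → ℤ) (t : ℝ), 1 ≤ |t| →
        ‖∫ k in torusBox d, Complex.exp (Complex.I * (phase ω lam t x k : ℂ)) * (χ k • η k)‖ ≤
          C / |t| ^ (1 / 2 : ℝ) * (torusGradL1 η + torusL1 η) := by
  obtain ⟨C, hC, h⟩ := exists_directional_bound hω hlam v hc
  have hcDχ : Continuous fun k => fderiv ℝ χ k v :=
    (hχ.continuous_fderiv one_ne_zero).clm_apply continuous_const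
  obtain ⟨M, hM⟩ := isCompact_closedTorusBox.exists_bound_of_continuousOn hcDχ.continuousOn
  have hM0 : 0 ≤ M := (norm_nonneg _).trans (hM 0 fun j _ => by
    simp [Real.pi_pos.le])
  refine ⟨C * (1 + M), fun η hη x t ht => ?_⟩
  have hχη : IsC1Torus fun k => χ k • η k :=
    ⟨hχ.smul hη.1, fun k j => congrArg₂ (· • ·) (hχper k j) (hη.2 k j)⟩
  refine (h _ hχη (fun k hk => hsupp k (left_ne_zero_of_smul hk)) x t ht).trans ?_
  have hcη := hη.1.continuous
  have hL1 : torusL1 (fun k => χ k • η k) ≤ torusL1 η := by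
    refine integral_mono (integrableOn_torusBox (hχ.continuous.smul hcη).norm)
      (integrableOn_torusBox hcη.norm) fun k => ?_
    simp only [norm_smul, Real.norm_eq_abs]
    exact mul_le_of_le_one_left (norm_nonneg _) (hχ1 k)
  have hcD : Continuous fun k => fderiv ℝ (fun k => χ k • η k) k v :=
    (hχη.1.continuous_fderiv one_ne_zero).clm_apply continuous_const
  have hcP : Continuous fun k => ∑ j, ‖partialDeriv j η k‖ :=
    continuous_finsetSum _ fun j _ =>
      ((hη.1.continuous_fderiv one_ne_zero).clm_apply continuous_const).norm
  have hgrad : ∫ k in torusBox d, ‖fderiv ℝ (fun k => χ k • η k) k v‖ ≤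
      torusGradL1 η + M * torusL1 η := by
    have hiP := integrableOn_torusBox hcP
    have hiN := (integrableOn_torusBox hcη.norm).const_mul M
    rw [torusGradL1, torusL1, ← integral_const_mul, ← integral_add hiP hiN]
    refine setIntegral_mono_on (integrableOn_torusBox hcD.norm) (hiP.add hiN)
      measurableSet_torusBox fun k hk => ?_
    rw [fderiv_fun_smul (hχ.differentiable one_ne_zero).differentiableAt
      (hη.1.differentiable one_ne_zero).differentiableAt]
    refine (norm_add_le _ _).trans (add_le_add ?_ ?_)
    · change ‖χ k • fderiv ℝ η k v‖ ≤ _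
      rw [norm_smul, Real.norm_eq_abs]
      exact (mul_le_of_le_one_left (norm_nonneg _) (hχ1 k)).trans (norm_fderiv_apply_le η k v hv)
    · change ‖fderiv ℝ χ k v • η k‖ ≤ _
      rw [norm_smul]
      exact mul_le_mul_of_nonneg_right (hM k (torusBox_subset hk)) (norm_nonneg _)
  have hG := torusGradL1_nonneg η
  have hL := torusL1_nonneg η
  calc _ ≤ C / |t| ^ (1 / 2 : ℝ) * ((torusGradL1 η + M * torusL1 η) + torusL1 η) := by gcongr
    _ ≤ C / |t| ^ (1 / 2 : ℝ) * ((1 + M) * (torusGradL1 η + torusL1 η)) := by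
        gcongr
        nlinarith [mul_nonneg hM0 hG]
    _ = _ := by ring

/-- A smooth even function of `r` with values in `[0, 1]`, equal to `0` for `2 r² ≤ c²` and to `1` for
`c² ≤ r²`. -/
noncomputable def cutoff (c r : ℝ) : ℝ := Real.smoothTransition (2 * (r / c) ^ 2 - 1)

lemma contDiff_cutoff (c : ℝ) : ContDiff ℝ 1 (cutoff c) :=
  (Real.smoothTransition.contDiff (n := 1)).comp (by fun_prop)

lemma cutoff_nonneg (c r : ℝ) : 0 ≤ cutoff c r := Real.smoothTransition.nonneg _

lemma cutoff_le_one (c r : ℝ) : cutoff c r ≤ 1 := Real.smoothTransition.le_one _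

lemma le_abs_of_cutoff_ne_zero {c r : ℝ} (hc : 0 < c) (h : cutoff c r ≠ 0) : c / 2 ≤ |r| := by
  have h1 : 0 < 2 * (r / c) ^ 2 - 1 := not_le.1 fun h' =>
    h (Real.smoothTransition.zero_of_nonpos h')
  rw [div_pow] at h1
  have h2 : c ^ 2 < 2 * r ^ 2 := by
    have h3 : 1 < 2 * r ^ 2 / c ^ 2 := by rw [mul_div_assoc]; linarith
    rwa [one_lt_div (by positivity)] at h3
  refine le_of_sq_le_sq ?_ (abs_nonneg r)
  rw [sq_abs]
  nlinarith

lemma sq_lt_of_cutoff_ne_one {c r : ℝ} (hc : 0 < c) (h : cutoff c r ≠ 1) : r ^ 2 < c ^ 2 := by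
  have h1 : 2 * (r / c) ^ 2 - 1 < 1 := not_le.1 fun h' =>
    h (Real.smoothTransition.one_of_one_le h')
  have h3 : r ^ 2 / c ^ 2 < 1 := by rw [← div_pow]; linarith
  rwa [div_lt_one (by positivity)] at h3

lemma exists_pos_le_sum_sq_gamDir₂ (hω : 0 < ω) (hlam : ∀ j, 0 < lam j) {a b : Fin d}
    (hab : a ≠ b) :
    ∃ c : ℝ, 0 < c ∧ ∀ k, 3 * c ^ 2 ≤ gamDir₂ ω lam (Pi.single a 1) k ^ 2 +
      gamDir₂ ω lam (Pi.single b 1) k ^ 2 +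
        gamDir₂ ω lam (Pi.single a 1 + Pi.single b 1) k ^ 2 := by
  set S : (Fin d → ℝ) → ℝ := fun k => gamDir₂ ω lam (Pi.single a 1) k ^ 2 +
      gamDir₂ ω lam (Pi.single b 1) k ^ 2 +
        gamDir₂ ω lam (Pi.single a 1 + Pi.single b 1) k ^ 2 with hS
  have hcg := fun v => (contDiff_gamDir₂ (ω := ω) (lam := lam) hω hlam v).continuous
  have hcS : Continuous S :=
    (((hcg _).pow 2).add ((hcg _).pow 2)).add ((hcg _).pow 2)
  have hper : IsTorusPeriodic S := fun k j => by
    simp only [hS, isTorusPeriodic_gamDir₂ _ k j]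
  have hne : (closedTorusBox d).Nonempty := ⟨0, fun j _ => by simp [Real.pi_pos.le]⟩
  obtain ⟨k₀, _, hmin⟩ := isCompact_closedTorusBox.exists_isMinOn hne hcS.continuousOn
  have hpos : 0 < S k₀ := by
    simp only [hS]
    rcases exists_gamDir₂_ne_zero hω hlam hab k₀ with h | h | h <;> positivity
  refine ⟨√(S k₀ / 3), by positivity, fun k => ?_⟩
  rw [Real.sq_sqrt (by positivity), mul_div_cancel₀ _ three_ne_zero]
  obtain ⟨k', hk', he⟩ := hper.exists_mem_closedTorusBox k
  change S k₀ ≤ S k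
  rw [he]
  exact hmin hk'

end Dispersion

end HarmonicLattice

open HarmonicLattice in
theorem theorem3p1 (d : ℕ) (hd : 2 ≤ d) (ω : ℝ) (hω : 0 < ω)
    (lam : Fin d → ℝ) (hlam : ∀ j, 0 < lam j) :
    ∃ C : ℝ, ∀ η : (Fin d → ℝ) → ℂ, HarmonicLattice.IsC1Torus η →
      ∀ (x : Fin d → ℤ) (t : ℝ), 1 ≤ |t| →
        ‖∫ k in HarmonicLattice.torusBox d,
            Complex.exp (Complex.I * (HarmonicLattice.phase ω lam t x k : ℂ)) * η k‖ ≤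
          C / |t| ^ (1 / 2 : ℝ) *
            (HarmonicLattice.torusGradL1 η + HarmonicLattice.torusL1 η) := by
  let a : Fin d := ⟨0, by omega⟩
  let b : Fin d := ⟨1, by omega⟩
  have hab : a ≠ b := by simp [a, b]
  obtain ⟨c, hc, hsum⟩ := exists_pos_le_sum_sq_gamDir₂ (lam := lam) hω hlam hab
  set g₁ := gamDir₂ ω lam (Pi.single a 1) with hg₁
  set g₂ := gamDir₂ ω lam (Pi.single b 1) with hg₂
  set g₃ := gamDir₂ ω lam (Pi.single a 1 + Pi.single b 1)
  have hva : ∀ i j : Fin d, |(Pi.single i 1 : Fin d → ℝ) j| ≤ 1 := by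
    intro i j
    rcases eq_or_ne j i with rfl | h
    · simp
    · simp [h]
  have hvc : ∀ j : Fin d, |(Pi.single a 1 + Pi.single b 1 : Fin d → ℝ) j| ≤ 1 := by
    intro j
    rcases eq_or_ne j a with rfl | h
    · simp [hab]
    · rw [Pi.add_apply, Pi.single_eq_of_ne h, zero_add]
      exact hva b j
  have hχ₁ : ContDiff ℝ 1 fun k => cutoff c (g₁ k) :=
    (contDiff_cutoff c).comp (contDiff_gamDir₂ hω hlam _)
  have hχ₂ : ContDiff ℝ 1 fun k => cutoff c (g₂ k) :=
    (contDiff_cutoff c).comp (contDiff_gamDir₂ hω hlam _)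
  have hp₁ : IsTorusPeriodic fun k => cutoff c (g₁ k) := fun k j => by
    simp only [hg₁, isTorusPeriodic_gamDir₂ _ k j]
  have hp₂ : IsTorusPeriodic fun k => cutoff c (g₂ k) := fun k j => by
    simp only [hg₂, isTorusPeriodic_gamDir₂ _ k j]
  have h0 : ∀ r, 0 ≤ cutoff c r := cutoff_nonneg c
  have h1 : ∀ r, cutoff c r ≤ 1 := cutoff_le_one c
  have habs : ∀ r, |cutoff c r| ≤ 1 := fun r => by rw [abs_of_nonneg (h0 r)]; exact h1 r
  have habs' : ∀ r, |1 - cutoff c r| ≤ 1 := fun r => by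
    rw [abs_of_nonneg (sub_nonneg.2 (h1 r))]; linarith [h0 r]
  -- The weights `h(g₁)`, `(1 - h(g₁)) h(g₂)` and `(1 - h(g₁)) (1 - h(g₂))`, with `h = cutoff c`,
  -- add up to `1`.
  obtain ⟨C₁, hb₁⟩ := exists_weighted_bound hω hlam (hva a) (half_pos hc) hχ₁ hp₁
    (fun k => habs _) fun k hk => le_abs_of_cutoff_ne_zero hc hk
  obtain ⟨C₂, hb₂⟩ := exists_weighted_bound hω hlam (hva b) (half_pos hc)
    (χ := fun k => (1 - cutoff c (g₁ k)) * cutoff c (g₂ k))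
    ((contDiff_const.sub hχ₁).mul hχ₂)
    (fun k j => congrArg₂ (fun p q : ℝ => (1 - p) * q) (hp₁ k j) (hp₂ k j))
    (fun k => by rw [abs_mul]; exact mul_le_one₀ (habs' _) (abs_nonneg _) (habs _))
    fun k hk => le_abs_of_cutoff_ne_zero hc (right_ne_zero_of_mul hk)
  obtain ⟨C₃, hb₃⟩ := exists_weighted_bound hω hlam hvc (half_pos hc)
    (χ := fun k => (1 - cutoff c (g₁ k)) * (1 - cutoff c (g₂ k)))
    ((contDiff_const.sub hχ₁).mul (contDiff_const.sub hχ₂))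
    (fun k j => congrArg₂ (fun p q : ℝ => (1 - p) * (1 - q)) (hp₁ k j) (hp₂ k j))
    (fun k => by rw [abs_mul]; exact mul_le_one₀ (habs' _) (abs_nonneg _) (habs' _)) fun k hk => by
      -- Here `g₁² < c²` and `g₂² < c²`, so `hsum` leaves `c² < g₃²`.
      have e1 := sq_lt_of_cutoff_ne_one hc (sub_ne_zero.1 (left_ne_zero_of_mul hk)).symm
      have e2 := sq_lt_of_cutoff_ne_one hc (sub_ne_zero.1 (right_ne_zero_of_mul hk)).symm
      refine le_of_sq_le_sq ?_ (abs_nonneg _)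
      rw [sq_abs]
      nlinarith [hsum k]
  refine ⟨C₁ + C₂ + C₃, fun η hη x t ht => ?_⟩
  have hcη := hη.1.continuous
  have hcE : Continuous fun k => Complex.exp (Complex.I * (phase ω lam t x k : ℂ)) := by
    have hcγ : Continuous (gam ω lam) := (contDiff_gam hω hlam).continuous
    simp only [phase]
    fun_prop
  have hint : ∀ χ : (Fin d → ℝ) → ℝ, Continuous χ → IntegrableOn
      (fun k => Complex.exp (Complex.I * (phase ω lam t x k : ℂ)) * (χ k • η k)) (torusBox d) :=
    fun χ hχ => integrableOn_torusBox (hcE.mul (hχ.smul hcη))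
  have hc₁ := hχ₁.continuous
  have hc₂ := hχ₂.continuous
  have i₁ := hint _ hc₁
  have i₂ := hint (fun k => (1 - cutoff c (g₁ k)) * cutoff c (g₂ k)) (by fun_prop)
  have i₃ := hint (fun k => (1 - cutoff c (g₁ k)) * (1 - cutoff c (g₂ k))) (by fun_prop)
  have hsplit : ∀ k, Complex.exp (Complex.I * (phase ω lam t x k : ℂ)) * η k =
      Complex.exp (Complex.I * (phase ω lam t x k : ℂ)) * (cutoff c (g₁ k) • η k) +
      Complex.exp (Complex.I * (phase ω lam t x k : ℂ)) *
        (((1 - cutoff c (g₁ k)) * cutoff c (g₂ k)) • η k) +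
      Complex.exp (Complex.I * (phase ω lam t x k : ℂ)) *
        (((1 - cutoff c (g₁ k)) * (1 - cutoff c (g₂ k))) • η k) := by
    intro k
    simp only [Complex.real_smul]
    push_cast
    ring
  have e := integral_add (i₁.add i₂) i₃
  simp only [Pi.add_apply] at e
  simp only [hsplit]
  rw [e, integral_add i₁ i₂, add_div, add_div, add_mul, add_mul]
  refine (norm_add_le _ _).trans (add_le_add ((norm_add_le _ _).trans (add_le_add ?_ ?_)) ?_)
  · exact hb₁ η hη x t ht
  · exact hb₂ η hη x t ht
  · exact hb₃ η hη x t ht
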